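/- For $0<\alpha<1$ let $E_\alpha(x)=\sum_{k=0}^{\infty}\frac{x^k}{\Gamma(\alpha k+1)}$, $x\in\mathbb R$, be the Mittag-Leffler function, and let $\mathrm{Ln}_\alpha:(0,\infty)\to\mathbb R$ be its inverse function. For a distribution function $F$ of a non-negative random variable, the extended fractional cumulative past entropy (EFCPE) of order $\alpha$ is $$\mathcal E^*_\alpha(F)=\int_0^\infty F(x)\,[-\mathrm{Ln}_\alpha F(x)]^{1/\alpha}\,dx\in[0,\infty],$$ where the integrand is $0$ at points with $F(x)=0$. Theorem 4.1. Let $0<\alpha<1$, and let $X$ be a non-negative random variable with distribution function $F$ and $E(|X|^p)<\infty$ for some $p>1$. Let $X_1,X_2,\ldots$ be independent random variables, each with the distribution of $X$, and let $\tilde F_n(x)=\frac1n\#\{i\le n: X_i\le x\}$ be the empirical distribution function of $X_1,\ldots,X_n$. Then, almost surely, $$\mathcal E^*_\alpha(\tilde F_n)\longrightarrow\mathcal E^*_\alpha(F)\quad\text{as } n\to\infty,$$ as a limit in $[0,\infty]$. -/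

import Mathlib

open MeasureTheory ProbabilityTheory Filter Topology

noncomputable section

/-- The Mittag-Leffler function `E_α(x) = ∑ₖ xᵏ / Γ(α k + 1)` of a real variable. -/
def mittagLeffler (α x : ℝ) : ℝ :=
  ∑' k : ℕ, x ^ k / Real.Gamma (α * k + 1)

/-- The fractional order logarithm `Ln_α`, the inverse function of `E_α : ℝ → ℝ`.
For `0 < α < 1` the range of `E_α` is `(0, ∞)`; the values outside it carry no meaning. -/
def fracLog (α u : ℝ) : ℝ :=
  Function.invFun (mittagLeffler α) u

/-- The extended fractional cumulative past entropy
`∫₀^∞ F(x) [-Ln_α F(x)]^{1/α} dx ∈ [0, ∞]` of a distribution function `F`.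
Where `F(x) = 0` the integrand is `0`, the usual convention `0 · [-Ln_α 0]^{1/α} = 0`. -/
def efcpe (α : ℝ) (F : ℝ → ℝ) : ENNReal :=
  ∫⁻ x in Set.Ioi (0 : ℝ), ENNReal.ofReal (F x * (-fracLog α (F x)) ^ (1 / α))

/-- The empirical distribution function of the sample `s 0, …, s (n - 1)`: the proportion of the
sample points that are at most `x`. -/
def empiricalCDF (s : ℕ → ℝ) (n : ℕ) (x : ℝ) : ℝ :=
  (((Finset.range n).filter (fun i => s i ≤ x)).card : ℝ) / (n : ℝ)

end

/-! Write h(u) = u (-Ln_α u)^{1/α} and β = 1/α - 1. The proof is a dichotomy: Fatou when the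
limiting entropy is infinite, dominated convergence when it is finite. The work lies in the
dominating function.

Two bounds carry the analysis: for 0 < u ≤ 1, u (-Ln_α u) ≤ Γ(1+α)(1-u) and 1-u ≤ Γ(1-α) u (-Ln_α
u). Since h(u) = (u (-Ln_α u))^{1/α} u^{-β}, they give h(u) ≤ C (1-u) u^{-β}, and h(u) ≥ c u^{-β}
for u ≤ 1/2. For large x, Markov's inequality for the empirical measure and the strong law for |X|^p
give 1 - F_n(x) ≤ M x^{-p}, integrable at infinity because p > 1. On a bounded interval the
dominating function is sup_n F_n^{-β}, with value 0 where F_n = 0. A Chernoff bound over dyadic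
sample sizes (`lintegral_iSup_empiricalCDF_rpow_le`) shows that its mean at x is at most C
F(x)^{-β}. The lower bound on h makes F^{-β} integrable on (0, K] when the entropy is finite, so by
Tonelli the supremum is almost surely integrable there.

The two bounds are inequalities for E_α(-x), x ≥ 0, obtained by discretization. The coefficients of
(1-X)^{α-1} / ((1-X)^α + l) are a discrete fractional relaxation; expanding in powers of l and
setting l = x/n^α, the n-th coefficient tends to E_α(-x) (`tendsto_fracRelaxation`). Positivity, the
two bounds and strict monotonicity come from coefficient inequalities that pass to the limit. -/

/-! ### Binomial series with negative exponent and the growth of their coefficients -/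

/-- The power series `(1 - X)^(-a)`. -/
noncomputable def negBinomialSeries (a : ℝ) : PowerSeries ℝ :=
  PowerSeries.mk fun n => ∏ i ∈ Finset.range n, (a + i) / (i + 1)

namespace negBinomialSeries

open PowerSeries

lemma coeff_eq (a : ℝ) (n : ℕ) :
    coeff n (negBinomialSeries a) = ∏ i ∈ Finset.range n, (a + i) / (i + 1) := by
  simp [negBinomialSeries]

lemma coeff_zero (a : ℝ) : coeff 0 (negBinomialSeries a) = 1 := by
  rw [coeff_eq]; simp

lemma coeff_succ (a : ℝ) (n : ℕ) :
    coeff (n + 1) (negBinomialSeries a) = coeff n (negBinomialSeries a) * ((a + n) / (n + 1)) := by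
  simp only [coeff_eq, Finset.prod_range_succ]

lemma one_sub_X_mul_derivative (a : ℝ) :
    (1 - X) * derivative ℝ (negBinomialSeries a) = C a * negBinomialSeries a := by
  ext n
  rw [sub_mul, one_mul, map_sub, coeff_C_mul, coeff_derivative, coeff_succ]
  have h : ((n : ℝ) + 1) ≠ 0 := by positivity
  cases n with
  | zero => simp [coeff_zero]
  | succ n =>
    rw [coeff_succ_X_mul, coeff_derivative]
    push_cast at h ⊢
    field_simp
    ring

lemma eq_of_one_sub_X_mul_derivative {a : ℝ} {f : PowerSeries ℝ} (h0 : coeff 0 f = 1)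
    (h : (1 - X) * derivative ℝ f = C a * f) : f = negBinomialSeries a := by
  have hrec : ∀ n : ℕ, coeff (n + 1) f = coeff n f * ((a + n) / (n + 1)) := by
    intro n
    have hn := congrArg (coeff n) h
    rw [sub_mul, one_mul, map_sub, coeff_C_mul, coeff_derivative] at hn
    have hpos : ((n : ℝ) + 1) ≠ 0 := by positivity
    cases n with
    | zero => simp at hn ⊢; linarith
    | succ n =>
      rw [coeff_succ_X_mul, coeff_derivative] at hn
      push_cast at hn hpos ⊢
      field_simp
      linarith
  ext n
  induction n with
  | zero => rw [h0, coeff_zero]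
  | succ n ih => rw [hrec, coeff_succ, ih]

/-- Both sides solve (1 - X) f' = (a + b) f with constant term 1, which determines f. -/
lemma mul_eq (a b : ℝ) :
    negBinomialSeries a * negBinomialSeries b = negBinomialSeries (a + b) := by
  apply eq_of_one_sub_X_mul_derivative
  · simp [coeff_mul, coeff_zero]
  · have ha := one_sub_X_mul_derivative a
    have hb := one_sub_X_mul_derivative b
    rw [Derivation.leibniz, smul_eq_mul, smul_eq_mul, map_add]
    linear_combination negBinomialSeries a * hb + negBinomialSeries b * ha

lemma zero_eq : negBinomialSeries 0 = 1 := by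
  symm
  apply eq_of_one_sub_X_mul_derivative <;> simp

lemma coeff_one (n : ℕ) : coeff n (negBinomialSeries 1) = 1 := by
  rw [coeff_eq]
  refine Finset.prod_eq_one fun i _ => ?_
  rw [add_comm]
  exact div_self (by positivity)

lemma coeff_nonneg {a : ℝ} (ha : 0 ≤ a) (n : ℕ) : 0 ≤ coeff n (negBinomialSeries a) := by
  rw [coeff_eq]
  exact Finset.prod_nonneg fun i _ => by positivity

lemma coeff_le_pow {a : ℝ} (ha : 0 ≤ a) (n : ℕ) :
    coeff n (negBinomialSeries a) ≤ (a + 1) ^ n := by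
  rw [coeff_eq, show (a + 1) ^ n = ∏ _i ∈ Finset.range n, (a + 1) by simp]
  refine Finset.prod_le_prod (fun i _ => by positivity) fun i _ => ?_
  rw [div_le_iff₀ (by positivity)]
  nlinarith [mul_nonneg ha (Nat.cast_nonneg (α := ℝ) i)]

lemma coeff_succ_neg_nonpos {α : ℝ} (hα0 : 0 < α) (hα1 : α < 1) (n : ℕ) :
    coeff (n + 1) (negBinomialSeries (-α)) ≤ 0 := by
  induction n with
  | zero => rw [coeff_succ, coeff_zero]; simp; linarith
  | succ n ih =>
    rw [coeff_succ]
    refine mul_nonpos_of_nonpos_of_nonneg ih (div_nonneg ?_ (by positivity))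
    push_cast
    linarith [Nat.cast_nonneg (α := ℝ) n]

lemma coeff_antitone {a : ℝ} (ha0 : 0 ≤ a) (ha1 : a ≤ 1) :
    Antitone fun n => coeff n (negBinomialSeries a) := by
  refine antitone_nat_of_succ_le fun n => ?_
  rw [coeff_succ]
  refine mul_le_of_le_one_right (coeff_nonneg ha0 n) ?_
  rw [div_le_one (by positivity)]
  linarith

lemma coeff_mul_one (f : PowerSeries ℝ) (n : ℕ) :
    coeff n (f * negBinomialSeries 1) = ∑ k ∈ Finset.range (n + 1), coeff k f := by
  simp [coeff_mul, coeff_one, Finset.Nat.sum_antidiagonal_eq_sum_range_succ_mk]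

/-- In the convolution ∑ f_k g_{n-k} each g_{n-k} is at least g_n, which leaves g_n times a partial
sum of f. All the relaxation inequalities rest on this. -/
lemma coeff_mul_ge {f g : PowerSeries ℝ} (hf : ∀ n, 0 ≤ coeff n f)
    (hg : Antitone fun n => coeff n g) (n : ℕ) :
    coeff n (f * negBinomialSeries 1) * coeff n g ≤ coeff n (f * g) := by
  rw [coeff_mul_one, coeff_mul, Finset.Nat.sum_antidiagonal_eq_sum_range_succ_mk, Finset.sum_mul]
  exact Finset.sum_le_sum fun k _ => mul_le_mul_of_nonneg_left (hg (Nat.sub_le n k)) (hf k)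

/-- The quotient is the reciprocal of a times Euler's product for Γ(a); the case a = 0 is separate
because Γ(a + 1) = a Γ(a) fails there. -/
lemma tendsto_coeff_div (a : ℝ) (ha : -1 < a) :
    Tendsto (fun n : ℕ => coeff n (negBinomialSeries (a + 1)) / (n : ℝ) ^ a) atTop
      (𝓝 (Real.Gamma (a + 1))⁻¹) := by
  rcases eq_or_ne a 0 with rfl | ha0
  · simp [coeff_one]
  have h := (((Real.GammaSeq_tendsto_Gamma a).const_mul a).inv₀
    (by rw [← Real.Gamma_add_one ha0]; exact (Real.Gamma_pos_of_pos (by linarith)).ne'))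
  rw [← Real.Gamma_add_one ha0] at h
  refine h.congr fun n => ?_
  have hp : ∏ j ∈ Finset.range n, (a + 1 + (j : ℝ)) ≠ 0 :=
    (Finset.prod_pos fun i _ => by linarith [Nat.cast_nonneg (α := ℝ) i]).ne'
  have hf : ∏ j ∈ Finset.range n, ((j : ℝ) + 1) = n.factorial := by
    rw [← Finset.prod_range_add_one_eq_factorial]; push_cast; rfl
  rw [Real.GammaSeq, Finset.prod_range_succ', coeff_eq, Finset.prod_div_distrib, hf]
  have : ∏ j ∈ Finset.range n, (a + ((j + 1 : ℕ) : ℝ)) = ∏ j ∈ Finset.range n, (a + 1 + (j : ℝ)) :=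
    Finset.prod_congr rfl fun i _ => by push_cast; ring
  rw [this]
  simp only [Nat.cast_zero, add_zero]
  field_simp

/-- The ratio of consecutive terms is (1 + a/(n+1)) (1 - 1/(n+1))^a ≤ e^{a/(n+1)} e^{-a/(n+1)} = 1.
Monotonicity makes one fixed index dominate all later ones and also the limit 1/Γ. -/
lemma coeff_div_antitone {a : ℝ} (ha : 0 ≤ a) {m n : ℕ} (hm : 1 ≤ m) (hmn : m ≤ n) :
    coeff n (negBinomialSeries (a + 1)) / (n : ℝ) ^ a ≤
      coeff m (negBinomialSeries (a + 1)) / (m : ℝ) ^ a := by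
  induction n, hmn using Nat.le_induction with
  | base => exact le_rfl
  | succ n hn ih =>
    refine le_trans ?_ ih
    have hn0 : (0 : ℝ) < n := by exact_mod_cast lt_of_lt_of_le hm hn
    have hc := coeff_nonneg (a := a + 1) (by linarith) n
    rw [coeff_succ, div_le_div_iff₀ (by positivity) (by positivity), mul_assoc]
    refine mul_le_mul_of_nonneg_left ?_ hc
    have h1 : (a + 1 + n) / ((n : ℝ) + 1) ≤ Real.exp (a * (1 / (n + 1))) := by
      have := Real.add_one_le_exp (a * (1 / ((n : ℝ) + 1)))
      refine le_trans (le_of_eq ?_) this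
      field_simp; ring
    have h2 : (n : ℝ) / (n + 1) ≤ Real.exp (-(1 / (n + 1))) := by
      have := Real.add_one_le_exp (-(1 / ((n : ℝ) + 1)))
      refine le_trans (le_of_eq ?_) this
      field_simp; ring
    have h3 : (n : ℝ) ^ a = ((n : ℝ) / (n + 1)) ^ a * ((n + 1 : ℕ) : ℝ) ^ a := by
      rw [← Real.mul_rpow (by positivity) (by positivity)]
      congr 1; push_cast; field_simp
    have h4 : ((n : ℝ) / (n + 1)) ^ a ≤ Real.exp (-(a * (1 / (n + 1)))) := by
      refine (Real.rpow_le_rpow (by positivity) h2 ha).trans (le_of_eq ?_)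
      rw [← Real.exp_mul]; congr 1; ring
    rw [h3, ← mul_assoc]
    refine mul_le_of_le_one_left (by positivity) ?_
    calc _ ≤ Real.exp (a * (1 / (n + 1))) * Real.exp (-(a * (1 / (n + 1)))) :=
          mul_le_mul h1 h4 (by positivity) (Real.exp_pos _).le
      _ = 1 := by rw [← Real.exp_add]; simp

end negBinomialSeries

/-! ### Discrete fractional relaxation -/

/-- The inverse of the power series `(1 - X)^α + l`. -/
noncomputable def fracResolvent (α l : ℝ) : PowerSeries ℝ :=
  (negBinomialSeries (-α) + PowerSeries.C l)⁻¹

/-- The generating function of the discrete fractional relaxation: `(1 - X)^(α - 1)` divided by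
`(1 - X)^α + l`. -/
noncomputable def fracRelaxation (α l : ℝ) : PowerSeries ℝ :=
  negBinomialSeries (1 - α) * fracResolvent α l

section FracRelaxation

open PowerSeries negBinomialSeries

variable {α l m : ℝ}

lemma mul_fracResolvent (hl : 0 ≤ l) :
    (negBinomialSeries (-α) + C l) * fracResolvent α l = 1 := by
  refine PowerSeries.mul_inv_cancel _ ?_
  rw [← coeff_zero_eq_constantCoeff_apply, map_add, negBinomialSeries.coeff_zero]
  simp
  linarith

/-- All coefficients of (1 - X)^α after the first are nonpositive, so the recursion expresses (1 +
l) times the n-th coefficient as a sum of nonnegative terms. -/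
lemma coeff_fracResolvent_nonneg (hα0 : 0 < α) (hα1 : α < 1) (hl : 0 ≤ l) (n : ℕ) :
    0 ≤ coeff n (fracResolvent α l) := by
  induction n using Nat.strong_induction_on with
  | _ n ih =>
    have h := congrArg (coeff n) (mul_fracResolvent (α := α) hl)
    rw [add_mul, map_add, coeff_C_mul, coeff_mul,
      Finset.Nat.sum_antidiagonal_eq_sum_range_succ_mk, Finset.sum_range_succ'] at h
    simp only [negBinomialSeries.coeff_zero, one_mul, Nat.sub_zero] at h
    have hs : ∑ k ∈ Finset.range n,
        coeff (k + 1) (negBinomialSeries (-α)) * coeff (n - (k + 1)) (fracResolvent α l) ≤ 0 := by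
      refine Finset.sum_nonpos fun k hk => ?_
      have := Finset.mem_range.1 hk
      exact mul_nonpos_of_nonpos_of_nonneg (coeff_succ_neg_nonpos hα0 hα1 k) (ih _ (by omega))
    have h1 : (0 : ℝ) ≤ coeff n (1 : PowerSeries ℝ) := by
      rw [PowerSeries.coeff_one]; split_ifs <;> norm_num
    by_contra! hneg
    nlinarith [mul_nonneg hl (neg_pos.2 hneg).le]

lemma fracRelaxation_eq (hl : 0 ≤ l) :
    fracRelaxation α l = negBinomialSeries 1 - C l * (fracResolvent α l * negBinomialSeries 1) := by
  have h := mul_fracResolvent (α := α) hl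
  rw [fracRelaxation, show (1 - α) = 1 + -α by ring, ← negBinomialSeries.mul_eq]
  linear_combination negBinomialSeries 1 * h

lemma coeff_fracRelaxation_nonneg (hα0 : 0 < α) (hα1 : α < 1) (hl : 0 ≤ l) (n : ℕ) :
    0 ≤ coeff n (fracRelaxation α l) := by
  rw [fracRelaxation, coeff_mul]
  exact Finset.sum_nonneg fun k _ => mul_nonneg (negBinomialSeries.coeff_nonneg (by linarith) _)
    (coeff_fracResolvent_nonneg hα0 hα1 hl _)

lemma coeff_fracRelaxation (hl : 0 ≤ l) (n : ℕ) :
    coeff n (fracRelaxation α l) = 1 - l * coeff n (fracResolvent α l * negBinomialSeries 1) := by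
  rw [fracRelaxation_eq hl, map_sub, coeff_C_mul, negBinomialSeries.coeff_one]

lemma coeff_fracRelaxation_antitone (hα0 : 0 < α) (hα1 : α < 1) (hl : 0 ≤ l) :
    Antitone fun n => coeff n (fracRelaxation α l) := by
  refine antitone_nat_of_succ_le fun n => ?_
  rw [coeff_fracRelaxation hl, coeff_fracRelaxation hl, coeff_mul_one, coeff_mul_one,
    Finset.sum_range_succ _ (n + 1)]
  nlinarith [mul_nonneg hl (coeff_fracResolvent_nonneg hα0 hα1 hl (n + 1))]

/-- Discrete form of the Volterra equation u = 1 - l I^α u; multiplication by (1 - X)^{-α} plays the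
fractional integral. -/
lemma fracRelaxation_eq_sub (hl : 0 ≤ l) :
    fracRelaxation α l =
      negBinomialSeries 1 - C l * (negBinomialSeries α * fracRelaxation α l) := by
  conv_lhs => rw [fracRelaxation_eq hl]
  rw [fracRelaxation, ← mul_assoc (negBinomialSeries α), negBinomialSeries.mul_eq,
    show α + (1 - α) = 1 by ring]
  ring

lemma fracRelaxation_upper (hα0 : 0 < α) (hα1 : α < 1) (hl : 0 ≤ l) (n : ℕ) :
    l * (coeff n (negBinomialSeries (α + 1)) * coeff n (fracRelaxation α l)) ≤
      1 - coeff n (fracRelaxation α l) := by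
  have h := congrArg (coeff n) (fracRelaxation_eq_sub (α := α) hl)
  rw [map_sub, coeff_C_mul, negBinomialSeries.coeff_one] at h
  have h2 := coeff_mul_ge (negBinomialSeries.coeff_nonneg hα0.le)
    (coeff_fracRelaxation_antitone hα0 hα1 hl) n
  rw [negBinomialSeries.mul_eq] at h2
  have := mul_le_mul_of_nonneg_left h2 hl
  linarith

lemma fracRelaxation_lower (hα0 : 0 < α) (hα1 : α < 1) (hl : 0 ≤ l) (n : ℕ) :
    coeff n (negBinomialSeries (1 - α)) * (1 - coeff n (fracRelaxation α l)) ≤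
      l * coeff n (fracRelaxation α l) := by
  have h2 := coeff_mul_ge (coeff_fracResolvent_nonneg hα0 hα1 hl)
    (coeff_antitone (a := 1 - α) (by linarith) (by linarith)) n
  have := mul_le_mul_of_nonneg_left h2 hl
  rw [mul_comm (fracResolvent α l) (negBinomialSeries (1 - α)), ← fracRelaxation] at this
  rw [coeff_fracRelaxation hl]
  rw [coeff_fracRelaxation hl] at this
  linarith

/-- The resolvent identity writes the difference as (m - l) times a product to which `coeff_mul_ge`
applies. This quantitative form keeps the monotonicity in x strict in the limit. -/
lemma fracRelaxation_sub_ge (hα0 : 0 < α) (hα1 : α < 1) (hl : 0 ≤ l) (hlm : l ≤ m) (n : ℕ) :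
    (m - l) * (coeff n (fracRelaxation α l) * (1 - coeff n (fracRelaxation α m))) ≤
      m * (coeff n (fracRelaxation α l) - coeff n (fracRelaxation α m)) := by
  have hm : 0 ≤ m := hl.trans hlm
  have h : fracRelaxation α l - fracRelaxation α m =
      C (m - l) * (fracResolvent α m * fracRelaxation α l) := by
    have h1 := mul_fracResolvent (α := α) hl
    have h2 := mul_fracResolvent (α := α) hm
    simp only [fracRelaxation, map_sub]
    linear_combination negBinomialSeries (1 - α) * (fracResolvent α m * h1 - fracResolvent α l * h2)
  have h' := congrArg (coeff n) h
  rw [map_sub, coeff_C_mul] at h'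
  rw [h', coeff_fracRelaxation hm]
  have h2 := coeff_mul_ge (coeff_fracResolvent_nonneg hα0 hα1 hm)
    (coeff_fracRelaxation_antitone hα0 hα1 hl) n
  have := mul_le_mul_of_nonneg_left h2 (mul_nonneg (sub_nonneg.2 hlm) hm)
  linarith

lemma fracRelaxation_expand (hl : 0 ≤ l) (K : ℕ) :
    fracRelaxation α l = ∑ k ∈ Finset.range K, C ((-l) ^ k) * negBinomialSeries (α * k + 1) +
      C ((-l) ^ K) * (negBinomialSeries (α * K) * fracRelaxation α l) := by
  induction K with
  | zero => simp [negBinomialSeries.zero_eq]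
  | succ K ih =>
    conv_lhs => rw [ih]
    rw [Finset.sum_range_succ, add_assoc]
    congr 1
    conv_lhs => rw [fracRelaxation_eq_sub hl]
    rw [← negBinomialSeries.mul_eq (α * K) 1,
      show α * ((K + 1 : ℕ) : ℝ) = α * K + α by push_cast; ring, ← negBinomialSeries.mul_eq,
      pow_succ, map_mul, map_neg]
    ring

end FracRelaxation

/-! ### The Mittag-Leffler function on the negative half-line and its inverse -/

section MittagLeffler

open PowerSeries negBinomialSeries

variable {α : ℝ}

lemma summable_add_two_pow_mul_geometric (N : ℕ) {r : ℝ} (hr0 : 0 ≤ r) (hr1 : r < 1) :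
    Summable fun k : ℕ => r ^ k * ((k : ℝ) + 2) ^ N := by
  -- A ratio strictly between r and 1, nonzero even when r = 0, so the index shift by 2 can be
  -- divided out.
  set s := (r + 1) / 2 with hs
  have hs0 : 0 < s := by positivity
  have h := summable_pow_mul_geometric_of_norm_lt_one N (r := s)
    (by rw [Real.norm_of_nonneg hs0.le]; linarith)
  have h2 := ((summable_nat_add_iff 2).2 h).mul_left (s⁻¹ ^ 2)
  refine Summable.of_nonneg_of_le (fun k => by positivity) (fun k => ?_) h2
  have : s⁻¹ ^ 2 * (((k + 2 : ℕ) : ℝ) ^ N * s ^ (k + 2)) = s ^ k * ((k : ℝ) + 2) ^ N := by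
    push_cast
    rw [pow_add]
    field_simp
  rw [this]
  have : r ≤ s := by linarith
  gcongr

lemma coeff_mul_nat_le (hα0 : 0 < α) (hα1 : α < 1) {b : ℝ} (hb0 : 0 ≤ b) (hb1 : b ≤ 1) (j k : ℕ) :
    coeff j (negBinomialSeries (α * k + b)) ≤ ((k : ℝ) + 2) ^ j := by
  have hk : (0 : ℝ) ≤ k := Nat.cast_nonneg k
  refine (coeff_le_pow (by positivity) j).trans ?_
  have : α * k ≤ k := mul_le_of_le_one_left hk hα1.le
  exact pow_le_pow_left₀ (by positivity) (by linarith) j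

lemma summable_pow_mul_coeff (hα0 : 0 < α) (hα1 : α < 1) {b : ℝ} (hb0 : 0 ≤ b) (hb1 : b ≤ 1)
    {l : ℝ} (hl : |l| < 1) (j : ℕ) :
    Summable fun k : ℕ => l ^ k * coeff j (negBinomialSeries (α * k + b)) := by
  refine Summable.of_norm_bounded
    (summable_add_two_pow_mul_geometric j (abs_nonneg l) hl) fun k => ?_
  rw [norm_mul, norm_pow, Real.norm_eq_abs,
    Real.norm_of_nonneg (negBinomialSeries.coeff_nonneg (by positivity) j)]
  exact mul_le_mul_of_nonneg_left (coeff_mul_nat_le hα0 hα1 hb0 hb1 j k) (by positivity)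

/-- The remainder of the K-step expansion has n-th coefficient at most l^K times a polynomial in K,
which vanishes in the limit as l < 1. -/
lemma hasSum_coeff_fracRelaxation (hα0 : 0 < α) (hα1 : α < 1) {l : ℝ} (hl0 : 0 ≤ l) (hl1 : l < 1)
    (n : ℕ) :
    HasSum (fun k : ℕ => (-l) ^ k * coeff n (negBinomialSeries (α * k + 1)))
      (coeff n (fracRelaxation α l)) := by
  have hl : |-l| < 1 := by rwa [abs_neg, abs_of_nonneg hl0]
  rw [(summable_pow_mul_coeff hα0 hα1 zero_le_one le_rfl hl n).hasSum_iff_tendsto_nat]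
  have hrem : Tendsto (fun K : ℕ => ∑ j ∈ Finset.range (n + 1),
      ((-l) ^ K * coeff j (negBinomialSeries (α * K + 0))) * coeff (n - j) (fracRelaxation α l))
      atTop (𝓝 (∑ j ∈ Finset.range (n + 1), 0 * coeff (n - j) (fracRelaxation α l))) :=
    tendsto_finsetSum _ fun j _ =>
      (summable_pow_mul_coeff hα0 hα1 le_rfl zero_le_one hl j).tendsto_atTop_zero.mul_const _
  have h := (tendsto_const_nhds (x := coeff n (fracRelaxation α l))).sub hrem
  simp only [zero_mul, Finset.sum_const_zero, sub_zero, add_zero] at h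
  refine h.congr fun K => ?_
  conv_lhs => rw [fracRelaxation_expand (α := α) hl0 K]
  rw [map_add, map_sum, coeff_C_mul, coeff_mul, Finset.Nat.sum_antidiagonal_eq_sum_range_succ_mk,
    Finset.mul_sum]
  simp only [coeff_C_mul, ← fracRelaxation_expand (α := α) hl0 K, mul_assoc, add_sub_cancel_right]

/-- Once N^α > R the terms are a geometric sequence in R/N^α times a factor polynomial in k. This
one majorant serves the series of E_α, its continuity and the discretization limit. -/
lemma exists_summable_bound (hα0 : 0 < α) (hα1 : α < 1) {R : ℝ} (hR : 0 ≤ R) :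
    ∃ N : ℕ, 1 ≤ N ∧ R / (N : ℝ) ^ α < 1 ∧ Summable fun k : ℕ =>
      R ^ k * (coeff N (negBinomialSeries (α * k + 1)) / (N : ℝ) ^ (α * k)) := by
  have h := (tendsto_rpow_atTop hα0).comp tendsto_natCast_atTop_atTop
  obtain ⟨N, hN, hN1⟩ := ((h.eventually_gt_atTop R).and (eventually_ge_atTop 1)).exists
  have hN0 : (0 : ℝ) < N := by exact_mod_cast hN1
  have hlt : R / (N : ℝ) ^ α < 1 := (div_lt_one (by positivity)).2 hN
  refine ⟨N, hN1, hlt, ?_⟩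
  refine (summable_pow_mul_coeff hα0 hα1 zero_le_one le_rfl (l := R / (N : ℝ) ^ α)
    (by rwa [abs_of_nonneg (by positivity)]) N).congr fun k => ?_
  rw [div_pow, Real.rpow_mul hN0.le, Real.rpow_natCast]
  ring

lemma inv_Gamma_le (hα0 : 0 < α) {N : ℕ} (hN : 1 ≤ N) (k : ℕ) :
    (Real.Gamma (α * k + 1))⁻¹ ≤ coeff N (negBinomialSeries (α * k + 1)) / (N : ℝ) ^ (α * k) := by
  have h0 : 0 ≤ α * k := by positivity
  refine le_of_tendsto (tendsto_coeff_div (α * k) (by linarith)) ?_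
  filter_upwards [eventually_ge_atTop N] with n hn
  exact coeff_div_antitone h0 hN hn

lemma norm_mittagLeffler_term_le (hα0 : 0 < α) {N : ℕ} (hN : 1 ≤ N) {R x : ℝ} (hx : |x| ≤ R)
    (k : ℕ) : ‖x ^ k / Real.Gamma (α * k + 1)‖ ≤
      R ^ k * (coeff N (negBinomialSeries (α * k + 1)) / (N : ℝ) ^ (α * k)) := by
  have hG : 0 < Real.Gamma (α * k + 1) := Real.Gamma_pos_of_pos (by positivity)
  rw [norm_div, norm_pow, Real.norm_eq_abs, Real.norm_of_nonneg hG.le, div_eq_mul_inv]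
  have := inv_Gamma_le hα0 hN k
  have hR : 0 ≤ R := (abs_nonneg x).trans hx
  gcongr

lemma summable_mittagLeffler (hα0 : 0 < α) (hα1 : α < 1) (x : ℝ) :
    Summable fun k : ℕ => x ^ k / Real.Gamma (α * k + 1) := by
  obtain ⟨N, hN, -, hs⟩ := exists_summable_bound hα0 hα1 (abs_nonneg x)
  exact Summable.of_norm_bounded hs (norm_mittagLeffler_term_le hα0 hN le_rfl)

lemma continuous_mittagLeffler (hα0 : 0 < α) (hα1 : α < 1) : Continuous (mittagLeffler α) := by
  rw [continuous_iff_continuousAt]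
  intro x
  obtain ⟨N, hN, -, hs⟩ := exists_summable_bound hα0 hα1 (R := |x| + 1) (by positivity)
  have h : ContinuousOn (mittagLeffler α) (Set.Icc (x - 1) (x + 1)) :=
    continuousOn_tsum (fun k => by fun_prop) hs fun k y hy =>
      norm_mittagLeffler_term_le hα0 hN (by
        have : |y - x| ≤ 1 := abs_le.2 ⟨by linarith [hy.1], by linarith [hy.2]⟩
        have := abs_add_le (y - x) x
        simp only [sub_add_cancel] at this
        linarith) k
  exact h.continuousAt (Icc_mem_nhds (by linarith) (by linarith))

lemma mittagLeffler_zero : mittagLeffler α 0 = 1 := by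
  rw [mittagLeffler, tsum_eq_single 0 (fun k hk => by simp [hk])]
  simp

lemma one_lt_mittagLeffler (hα0 : 0 < α) (hα1 : α < 1) {x : ℝ} (hx : 0 < x) :
    1 < mittagLeffler α x := by
  have hG : ∀ k : ℕ, 0 < Real.Gamma (α * k + 1) := fun k => Real.Gamma_pos_of_pos (by positivity)
  have h := (summable_mittagLeffler hα0 hα1 x).sum_le_tsum (Finset.range 2) fun k _ =>
    div_nonneg (pow_nonneg hx.le k) (hG k).le
  have h1 := div_pos (pow_pos hx 1) (hG 1)
  rw [Finset.sum_range_succ, Finset.sum_range_one] at h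
  simp only [pow_zero, Nat.cast_zero, mul_zero, zero_add, Real.Gamma_one, div_one] at h
  rw [mittagLeffler]
  linarith

/-- With l = x/n^α the k-th term of the expansion tends to (-x)^k/Γ(αk+1), since the n-th
coefficient of (1 - X)^{-(αk+1)} grows like n^{αk}/Γ(αk+1). -/
lemma tendsto_fracRelaxation (hα0 : 0 < α) (hα1 : α < 1) {x : ℝ} (hx : 0 ≤ x) :
    Tendsto (fun n : ℕ => coeff n (fracRelaxation α (x / (n : ℝ) ^ α))) atTop
      (𝓝 (mittagLeffler α (-x))) := by
  obtain ⟨N, hN, hlt, hs⟩ := exists_summable_bound hα0 hα1 hx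
  have key : Tendsto (fun n : ℕ => ∑' k : ℕ,
      (-x) ^ k * (coeff n (negBinomialSeries (α * k + 1)) / (n : ℝ) ^ (α * k))) atTop
      (𝓝 (∑' k : ℕ, (-x) ^ k / Real.Gamma (α * k + 1))) := by
    refine tendsto_tsum_of_dominated_convergence hs (fun k => ?_) ?_
    · have h0 : 0 ≤ α * k := by positivity
      exact (tendsto_coeff_div (α * k) (by linarith)).const_mul _
    · filter_upwards [eventually_ge_atTop N] with n hn k
      have h0 : 0 ≤ α * k := by positivity
      have hc := negBinomialSeries.coeff_nonneg (a := α * k + 1) (by positivity) n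
      rw [norm_mul, norm_pow, norm_neg, Real.norm_of_nonneg hx,
        Real.norm_of_nonneg (by positivity)]
      exact mul_le_mul_of_nonneg_left (coeff_div_antitone h0 hN hn) (by positivity)
  refine key.congr' ?_
  filter_upwards [eventually_ge_atTop N] with n hn
  have hN0 : (0 : ℝ) < N := by exact_mod_cast hN
  have hNn : (N : ℝ) ≤ n := by exact_mod_cast hn
  have hn0 : (0 : ℝ) < n := hN0.trans_le hNn
  have hlt' : x / (n : ℝ) ^ α < 1 := by
    refine lt_of_le_of_lt ?_ hlt
    gcongr
  rw [← (hasSum_coeff_fracRelaxation hα0 hα1 (by positivity) hlt' n).tsum_eq]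
  refine tsum_congr fun k => ?_
  rw [Real.rpow_mul hn0.le, Real.rpow_natCast, ← neg_div, div_pow]
  ring

lemma mul_mittagLeffler_neg_le (hα0 : 0 < α) (hα1 : α < 1) {x : ℝ} (hx : 0 ≤ x) :
    x * mittagLeffler α (-x) ≤ Real.Gamma (α + 1) * (1 - mittagLeffler α (-x)) := by
  have hG : 0 < Real.Gamma (α + 1) := Real.Gamma_pos_of_pos (by linarith)
  have ht := tendsto_fracRelaxation hα0 hα1 hx
  have h : x * ((Real.Gamma (α + 1))⁻¹ * mittagLeffler α (-x)) ≤ 1 - mittagLeffler α (-x) := by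
    refine le_of_tendsto_of_tendsto' (((tendsto_coeff_div α (by linarith)).mul ht).const_mul x)
      (ht.const_sub 1) fun n => ?_
    refine le_trans (le_of_eq ?_)
      (fracRelaxation_upper (l := x / (n : ℝ) ^ α) hα0 hα1 (by positivity) n)
    ring
  calc _ = Real.Gamma (α + 1) * (x * ((Real.Gamma (α + 1))⁻¹ * mittagLeffler α (-x))) := by
        field_simp
    _ ≤ _ := mul_le_mul_of_nonneg_left h hG.le

lemma one_sub_mittagLeffler_neg_le (hα0 : 0 < α) (hα1 : α < 1) {x : ℝ} (hx : 0 ≤ x) :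
    1 - mittagLeffler α (-x) ≤ Real.Gamma (1 - α) * (x * mittagLeffler α (-x)) := by
  have hG : 0 < Real.Gamma (1 - α) := Real.Gamma_pos_of_pos (by linarith)
  have ht := tendsto_fracRelaxation hα0 hα1 hx
  have hb := tendsto_coeff_div (-α) (by linarith)
  rw [show -α + 1 = 1 - α by ring] at hb
  have h : (Real.Gamma (1 - α))⁻¹ * (1 - mittagLeffler α (-x)) ≤ x * mittagLeffler α (-x) := by
    refine le_of_tendsto_of_tendsto (hb.mul (ht.const_sub 1)) (ht.const_mul x) ?_
    filter_upwards [eventually_ge_atTop 1] with n hn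
    have hn0 : (0 : ℝ) < n := by exact_mod_cast hn
    have hp : 0 < (n : ℝ) ^ α := by positivity
    have := mul_le_mul_of_nonneg_left
      (fracRelaxation_lower (l := x / (n : ℝ) ^ α) hα0 hα1 (by positivity) n) hp.le
    refine le_trans (le_of_eq ?_) (this.trans (le_of_eq ?_))
    · rw [Real.rpow_neg hn0.le]; field_simp
    · field_simp
  rwa [inv_mul_le_iff₀ hG] at h

lemma mittagLeffler_neg_nonneg (hα0 : 0 < α) (hα1 : α < 1) {x : ℝ} (hx : 0 ≤ x) :
    0 ≤ mittagLeffler α (-x) :=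
  ge_of_tendsto' (tendsto_fracRelaxation hα0 hα1 hx) fun n =>
    coeff_fracRelaxation_nonneg hα0 hα1 (by positivity) n

lemma mittagLeffler_neg_pos (hα0 : 0 < α) (hα1 : α < 1) {x : ℝ} (hx : 0 ≤ x) :
    0 < mittagLeffler α (-x) := by
  refine lt_of_le_of_ne (mittagLeffler_neg_nonneg hα0 hα1 hx) fun h => ?_
  have := one_sub_mittagLeffler_neg_le hα0 hα1 hx
  rw [← h] at this
  norm_num at this

lemma mittagLeffler_neg_lt_one (hα0 : 0 < α) (hα1 : α < 1) {x : ℝ} (hx : 0 < x) :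
    mittagLeffler α (-x) < 1 := by
  have h := mul_mittagLeffler_neg_le hα0 hα1 hx.le
  have h0 := mul_pos hx (mittagLeffler_neg_pos hα0 hα1 hx.le)
  have hG : 0 < Real.Gamma (α + 1) := Real.Gamma_pos_of_pos (by linarith)
  have := pos_of_mul_pos_right (h0.trans_le h) hG.le
  linarith

lemma mittagLeffler_neg_strictAntiOn (hα0 : 0 < α) (hα1 : α < 1) :
    StrictAntiOn (fun x => mittagLeffler α (-x)) (Set.Ici 0) := by
  intro x hx z hz hxz
  simp only [Set.mem_Ici] at hx hz
  have hz0 : 0 < z := lt_of_le_of_lt hx hxz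
  have htx := tendsto_fracRelaxation hα0 hα1 hx
  have htz := tendsto_fracRelaxation hα0 hα1 hz
  have h : (z - x) * (mittagLeffler α (-x) * (1 - mittagLeffler α (-z))) ≤
      z * (mittagLeffler α (-x) - mittagLeffler α (-z)) := by
    refine le_of_tendsto_of_tendsto ((htx.mul (htz.const_sub 1)).const_mul _)
      ((htx.sub htz).const_mul _) ?_
    filter_upwards [eventually_ge_atTop 1] with n hn
    have hn0 : (0 : ℝ) < n := by exact_mod_cast hn
    have hp : 0 < (n : ℝ) ^ α := by positivity
    have := mul_le_mul_of_nonneg_left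
      (fracRelaxation_sub_ge (l := x / (n : ℝ) ^ α) (m := z / (n : ℝ) ^ α) hα0 hα1 (by positivity)
        (by gcongr) n) hp.le
    refine le_trans (le_of_eq ?_) (this.trans (le_of_eq ?_)) <;> field_simp
  have hpos := mul_pos (sub_pos.2 hxz) (mul_pos (mittagLeffler_neg_pos hα0 hα1 hx)
    (sub_pos.2 (mittagLeffler_neg_lt_one hα0 hα1 hz0)))
  have := pos_of_mul_pos_right (hpos.trans_le h) hz0.le
  simpa using this

lemma exists_mittagLeffler_neg_eq (hα0 : 0 < α) (hα1 : α < 1) {u : ℝ} (hu0 : 0 < u) (hu1 : u ≤ 1) :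
    ∃ x, 0 ≤ x ∧ mittagLeffler α (-x) = u := by
  have hG : 0 < Real.Gamma (α + 1) := Real.Gamma_pos_of_pos (by linarith)
  -- The upper bound gives E_α(-z) ≤ Γ(α+1)/z, which equals u for this z.
  set z := Real.Gamma (α + 1) / u with hz
  have hz0 : 0 < z := by positivity
  have hle : mittagLeffler α (-z) ≤ u := by
    have h := mul_mittagLeffler_neg_le hα0 hα1 hz0.le
    have h0 := mittagLeffler_neg_pos hα0 hα1 hz0.le
    have : z * mittagLeffler α (-z) ≤ Real.Gamma (α + 1) := by nlinarith
    rw [hz, div_mul_eq_mul_div, div_le_iff₀ hu0] at this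
    exact le_of_mul_le_mul_left this hG
  have hc : ContinuousOn (fun x => mittagLeffler α (-x)) (Set.Icc 0 z) :=
    ((continuous_mittagLeffler hα0 hα1).comp continuous_neg).continuousOn
  obtain ⟨x, hx, hxu⟩ := intermediate_value_Icc' hz0.le hc
    (show u ∈ Set.Icc (mittagLeffler α (-z)) (mittagLeffler α (-0)) from
      ⟨hle, by rwa [neg_zero, mittagLeffler_zero]⟩)
  exact ⟨x, hx.1, hxu⟩

lemma mittagLeffler_fracLog (hα0 : 0 < α) (hα1 : α < 1) {u : ℝ} (hu0 : 0 < u) (hu1 : u ≤ 1) :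
    mittagLeffler α (fracLog α u) = u := by
  obtain ⟨x, -, hx⟩ := exists_mittagLeffler_neg_eq hα0 hα1 hu0 hu1
  exact Function.invFun_eq ⟨-x, hx⟩

/-- E_α exceeds 1 on the positive half-line, so whichever preimage of u is chosen must be
nonpositive. -/
lemma neg_fracLog_nonneg (hα0 : 0 < α) (hα1 : α < 1) {u : ℝ} (hu0 : 0 < u) (hu1 : u ≤ 1) :
    0 ≤ -fracLog α u := by
  by_contra! h
  have := one_lt_mittagLeffler hα0 hα1 (x := fracLog α u) (by linarith)
  rw [mittagLeffler_fracLog hα0 hα1 hu0 hu1] at this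
  linarith

lemma mul_neg_fracLog_le (hα0 : 0 < α) (hα1 : α < 1) {u : ℝ} (hu0 : 0 < u) (hu1 : u ≤ 1) :
    u * -fracLog α u ≤ Real.Gamma (α + 1) * (1 - u) := by
  have h := mul_mittagLeffler_neg_le hα0 hα1 (neg_fracLog_nonneg hα0 hα1 hu0 hu1)
  rw [neg_neg, mittagLeffler_fracLog hα0 hα1 hu0 hu1] at h
  linarith

lemma one_sub_le_mul_neg_fracLog (hα0 : 0 < α) (hα1 : α < 1) {u : ℝ} (hu0 : 0 < u) (hu1 : u ≤ 1) :
    1 - u ≤ Real.Gamma (1 - α) * (u * -fracLog α u) := by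
  have h := one_sub_mittagLeffler_neg_le hα0 hα1 (neg_fracLog_nonneg hα0 hα1 hu0 hu1)
  rw [neg_neg, mittagLeffler_fracLog hα0 hα1 hu0 hu1] at h
  linarith

lemma continuousOn_neg_fracLog (hα0 : 0 < α) (hα1 : α < 1) :
    ContinuousOn (fun u => -fracLog α u) (Set.Ioc 0 1) := by
  have hanti := mittagLeffler_neg_strictAntiOn hα0 hα1
  have hL : ∀ u ∈ Set.Ioc (0 : ℝ) 1, mittagLeffler α (-(-fracLog α u)) = u := fun u hu => by
    rw [neg_neg, mittagLeffler_fracLog hα0 hα1 hu.1 hu.2]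
  intro u hu
  have hLu := neg_fracLog_nonneg hα0 hα1 hu.1 hu.2
  refine tendsto_order.2 ⟨fun a ha => ?_, fun b hb => ?_⟩
  · rcases lt_or_ge a 0 with ha0 | ha0
    · filter_upwards [self_mem_nhdsWithin] with v hv
      exact ha0.trans_le (neg_fracLog_nonneg hα0 hα1 hv.1 hv.2)
    · have h1 : u < mittagLeffler α (-a) := by
        have := hanti ha0 hLu ha
        simpa only [hL u hu] using this
      filter_upwards [self_mem_nhdsWithin, mem_nhdsWithin_of_mem_nhds (Iio_mem_nhds h1)]
        with v hv hv'
      refine (hanti.lt_iff_gt (neg_fracLog_nonneg hα0 hα1 hv.1 hv.2) ha0).1 ?_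
      simpa only [hL v hv, Set.mem_Iio] using hv'
  · have hb0 : 0 ≤ b := hLu.trans hb.le
    have h1 : mittagLeffler α (-b) < u := by
      have := hanti hLu hb0 hb
      simpa only [hL u hu] using this
    filter_upwards [self_mem_nhdsWithin, mem_nhdsWithin_of_mem_nhds (Ioi_mem_nhds h1)]
      with v hv hv'
    refine (hanti.lt_iff_gt hb0 (neg_fracLog_nonneg hα0 hα1 hv.1 hv.2)).1 ?_
    simpa only [hL v hv, Set.mem_Ioi] using hv'

end MittagLeffler

/-! ### Two-sided bounds and regularity of the entropy kernel -/

/-- The integrand `u [-Ln_α u]^{1/α}` of the extended fractional cumulative past entropy. -/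
noncomputable def pastEntropyKernel (α u : ℝ) : ℝ := u * (-fracLog α u) ^ (1 / α)

section PastEntropyKernel

variable {α : ℝ}

lemma pastEntropyKernel_zero : pastEntropyKernel α 0 = 0 := by simp [pastEntropyKernel]

lemma pastEntropyKernel_eq (hα0 : 0 < α) (hα1 : α < 1) {u : ℝ} (hu0 : 0 < u) (hu1 : u ≤ 1) :
    pastEntropyKernel α u = (u * -fracLog α u) ^ (1 / α) * u ^ (-(1 / α - 1)) := by
  rw [pastEntropyKernel, Real.mul_rpow hu0.le (neg_fracLog_nonneg hα0 hα1 hu0 hu1), mul_right_comm,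
    ← Real.rpow_add hu0]
  simp

lemma pastEntropyKernel_le (hα0 : 0 < α) (hα1 : α < 1) :
    ∃ C, 0 < C ∧ ∀ u, 0 < u → u ≤ 1 →
      pastEntropyKernel α u ≤ C * ((1 - u) * u ^ (-(1 / α - 1))) := by
  have hG : 0 < Real.Gamma (α + 1) := Real.Gamma_pos_of_pos (by linarith)
  have h1α : 1 ≤ 1 / α := by rw [le_div_iff₀ hα0]; linarith
  refine ⟨Real.Gamma (α + 1) ^ (1 / α), by positivity, fun u hu0 hu1 => ?_⟩
  rw [pastEntropyKernel_eq hα0 hα1 hu0 hu1, ← mul_assoc]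
  refine mul_le_mul_of_nonneg_right ?_ (by positivity)
  have h0 := mul_nonneg hu0.le (neg_fracLog_nonneg hα0 hα1 hu0 hu1)
  refine (Real.rpow_le_rpow h0 (mul_neg_fracLog_le hα0 hα1 hu0 hu1) (by positivity)).trans ?_
  rw [Real.mul_rpow hG.le (by linarith)]
  refine mul_le_mul_of_nonneg_left ?_ (by positivity)
  -- One power of 1 - u suffices: it is what the moment bound on the tail controls.
  calc (1 - u) ^ (1 / α) ≤ (1 - u) ^ (1 : ℝ) :=
        Real.rpow_le_rpow_of_exponent_ge_of_imp (by linarith) (by linarith) h1α (by simp [hα0.ne'])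
    _ = 1 - u := Real.rpow_one _

lemma pastEntropyKernel_ge (hα0 : 0 < α) (hα1 : α < 1) :
    ∃ c, 0 < c ∧ ∀ u, 0 < u → u ≤ 1 / 2 → c * u ^ (-(1 / α - 1)) ≤ pastEntropyKernel α u := by
  have hG : 0 < Real.Gamma (1 - α) := Real.Gamma_pos_of_pos (by linarith)
  refine ⟨(1 / (2 * Real.Gamma (1 - α))) ^ (1 / α), by positivity, fun u hu0 hu1 => ?_⟩
  rw [pastEntropyKernel_eq hα0 hα1 hu0 (by linarith)]
  refine mul_le_mul_of_nonneg_right ?_ (by positivity)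
  refine Real.rpow_le_rpow (by positivity) ?_ (by positivity)
  have h := one_sub_le_mul_neg_fracLog hα0 hα1 hu0 (by linarith)
  rw [div_le_iff₀ (by positivity)]
  linarith

lemma continuousOn_pastEntropyKernel (hα0 : 0 < α) (hα1 : α < 1) :
    ContinuousOn (pastEntropyKernel α) (Set.Ioc 0 1) := by
  refine continuousOn_id.mul ((continuousOn_neg_fracLog hα0 hα1).rpow_const fun u _ => ?_)
  exact Or.inr (by positivity)

/-- The kernel is controlled only on (0, 1], where it is continuous, and at 0, where it vanishes; F
takes no other values. -/
lemma measurable_pastEntropyKernel_comp (hα0 : 0 < α) (hα1 : α < 1) {F : ℝ → ℝ} (hF : Measurable F)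
    (h0 : ∀ x, 0 ≤ F x) (h1 : ∀ x, F x ≤ 1) : Measurable fun x => pastEntropyKernel α (F x) := by
  classical
  have h : Measurable ((Set.Ioc (0 : ℝ) 1).piecewise (pastEntropyKernel α) 0) :=
    ContinuousOn.measurable_piecewise (continuousOn_pastEntropyKernel hα0 hα1)
      continuousOn_const measurableSet_Ioc
  convert h.comp hF using 1
  funext x
  rcases (h0 x).eq_or_lt with hx | hx
  · simp [← hx, pastEntropyKernel_zero]
  · simp [hx, h1 x]

end PastEntropyKernel

/-! ### Empirical distribution functions and the maximal inequality for their inverse powers -/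

section EmpiricalCDF

/-- The indicator of `(-∞, x]`. -/
noncomputable def iicIndicator (x : ℝ) : ℝ → ℝ := (Set.Iic x).indicator 1

lemma measurable_iicIndicator (x : ℝ) : Measurable (iicIndicator x) :=
  measurable_one.indicator measurableSet_Iic

lemma iicIndicator_eq (x y : ℝ) : iicIndicator x y = if y ≤ x then 1 else 0 := by
  simp [iicIndicator, Set.indicator]

lemma card_filter_eq_sum_iicIndicator (s : ℕ → ℝ) (n : ℕ) (x : ℝ) :
    (((Finset.range n).filter (fun i => s i ≤ x)).card : ℝ) =
      ∑ i ∈ Finset.range n, iicIndicator x (s i) := by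
  simp only [iicIndicator_eq, Finset.sum_boole]

lemma empiricalCDF_eq (s : ℕ → ℝ) (n : ℕ) (x : ℝ) :
    empiricalCDF s n x = (∑ i ∈ Finset.range n, iicIndicator x (s i)) / n := by
  rw [empiricalCDF, card_filter_eq_sum_iicIndicator]

lemma empiricalCDF_nonneg (s : ℕ → ℝ) (n : ℕ) (x : ℝ) : 0 ≤ empiricalCDF s n x := by
  unfold empiricalCDF; positivity

lemma empiricalCDF_le_one (s : ℕ → ℝ) (n : ℕ) (x : ℝ) : empiricalCDF s n x ≤ 1 := by
  refine div_le_one_of_le₀ ?_ (by positivity)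
  exact_mod_cast (Finset.card_filter_le _ _).trans (Finset.card_range n).le

/-- Markov's inequality for the empirical measure. -/
lemma one_sub_empiricalCDF_le (s : ℕ → ℝ) {n : ℕ} (hn : 1 ≤ n) {x p : ℝ} (hx : 0 < x)
    (hp : 0 < p) :
    1 - empiricalCDF s n x ≤ ((∑ i ∈ Finset.range n, |s i| ^ p) / n) * x ^ (-p) := by
  have hn0 : (0 : ℝ) < n := by exact_mod_cast hn
  have h : ∑ i ∈ Finset.range n, (1 - iicIndicator x (s i)) ≤
      ∑ i ∈ Finset.range n, |s i| ^ p * x ^ (-p) := by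
    refine Finset.sum_le_sum fun i _ => ?_
    rw [iicIndicator_eq]
    split_ifs with hi
    · rw [sub_self]; positivity
    · push Not at hi
      rw [sub_zero, Real.rpow_neg hx.le, ← div_eq_mul_inv, one_le_div (by positivity)]
      exact Real.rpow_le_rpow hx.le (hi.le.trans (le_abs_self _)) hp.le
  rw [Finset.sum_sub_distrib, ← Finset.sum_mul] at h
  simp only [Finset.sum_const, Finset.card_range, nsmul_eq_mul, mul_one] at h
  rw [empiricalCDF_eq, div_mul_eq_mul_div, one_sub_div hn0.ne']
  gcongr

/-- Compare n with the dyadic 2^j ≤ n < 2^{j+1}. If c(2^j) > 2^j q/8, or if 2^j q < 1, then n/c(n) ≤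
16/q; otherwise the trivial n/c(n) ≤ 2^{j+1} is charged to the bad event at level j. When c(n) = 0
the left side is 0, since 0 to a nonzero power is 0. -/
lemma natCast_card_div_rpow_le {c : ℕ → ℕ} (hc : Monotone c) {q β : ℝ} (hq : 0 < q) (hβ : 0 < β)
    (n : ℕ) :
    ENNReal.ofReal (((c n : ℝ) / n) ^ (-β)) ≤ ENNReal.ofReal ((16 / q) ^ β) +
      ∑' j : ℕ, if 1 ≤ 2 ^ j * q ∧ (c (2 ^ j) : ℝ) ≤ 2 ^ j * q / 8 then
        ENNReal.ofReal ((2 ^ (j + 1)) ^ β) else 0 := by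
  rcases Nat.eq_zero_or_pos n with rfl | hn
  · simp [Real.zero_rpow (neg_ne_zero.2 hβ.ne')]
  rcases Nat.eq_zero_or_pos (c n) with h0 | hcn
  · simp [h0, Real.zero_rpow (neg_ne_zero.2 hβ.ne')]
  have hn0 : (0 : ℝ) < n := by exact_mod_cast hn
  have hcn1 : (1 : ℝ) ≤ c n := by exact_mod_cast hcn
  have hcn0 : (0 : ℝ) < c n := by linarith
  set j := Nat.log 2 n with hj
  have hj1 : 2 ^ j ≤ n := Nat.pow_log_le_self 2 hn.ne'
  have hj2 : (n : ℝ) ≤ 2 ^ (j + 1) := by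
    exact_mod_cast (Nat.lt_pow_succ_log_self (by norm_num) n).le
  have hmono : (c (2 ^ j) : ℝ) ≤ c n := by exact_mod_cast hc hj1
  rw [Real.rpow_neg (by positivity), ← Real.inv_rpow (by positivity), inv_div]
  have hnc : (n : ℝ) / c n ≤ 2 ^ (j + 1) := (div_le_self hn0.le hcn1).trans hj2
  by_cases hcase : 1 ≤ 2 ^ j * q ∧ (c (2 ^ j) : ℝ) ≤ 2 ^ j * q / 8
  · refine le_trans ?_ le_add_self
    refine le_trans ?_ (ENNReal.le_tsum j)
    rw [if_pos hcase]
    exact ENNReal.ofReal_le_ofReal (Real.rpow_le_rpow (by positivity) hnc hβ.le)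
  · refine le_trans ?_ le_self_add
    refine ENNReal.ofReal_le_ofReal (Real.rpow_le_rpow (by positivity) ?_ hβ.le)
    have h2 : (0 : ℝ) < 2 ^ j := by positivity
    rw [pow_succ] at hnc hj2
    rw [div_le_div_iff₀ hcn0 hq]
    by_cases h1 : 1 ≤ 2 ^ j * q
    · have h3 : 2 ^ j * q / 8 < c (2 ^ j) := by
        by_contra! h; exact hcase ⟨h1, h⟩
      nlinarith
    · push Not at h1
      nlinarith

lemma tsum_two_pow_mul_inv_le {q : ℝ} (hq : 0 < q) :
    ∑' j : ℕ, (if 1 ≤ 2 ^ j * q then ENNReal.ofReal ((2 ^ j * q)⁻¹) else 0) ≤ 2 := by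
  have hex : ∃ j : ℕ, 1 ≤ 2 ^ j * q := by
    obtain ⟨j, hj⟩ := pow_unbounded_of_one_lt (q⁻¹) (one_lt_two (α := ℝ))
    exact ⟨j, by rw [inv_lt_iff_one_lt_mul₀ hq] at hj; linarith⟩
  classical
  rw [← Summable.sum_add_tsum_nat_add' (k := Nat.find hex) ENNReal.summable]
  rw [Finset.sum_eq_zero fun j hj => if_neg (Nat.find_min hex (Finset.mem_range.1 hj)), zero_add]
  have h2 : (2 : ENNReal) = ∑' i : ℕ, (2⁻¹ : ENNReal) ^ i := by
    rw [ENNReal.tsum_geometric, ENNReal.one_sub_inv_two, inv_inv]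
  rw [h2]
  refine ENNReal.tsum_le_tsum fun i => ?_
  split_ifs
  · rw [ENNReal.inv_pow.symm, ← ENNReal.ofReal_ofNat 2, ← ENNReal.ofReal_pow (by norm_num),
      ← ENNReal.ofReal_inv_of_pos (by positivity)]
    refine ENNReal.ofReal_le_ofReal (inv_anti₀ (by positivity) ?_)
    have := Nat.find_spec hex
    rw [pow_add, mul_assoc]
    exact le_mul_of_one_le_right (by positivity) this
  · exact zero_le

/-- Raise t ≤ e^t with t = y/(2(β+1)) to the power β + 1. The decay 1/y is what makes the dyadic sum
geometric. -/
lemma rpow_mul_exp_neg_half_le {β y : ℝ} (hβ : 0 < β) (hy : 0 < y) :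
    y ^ β * Real.exp (-(y / 2)) ≤ (2 * (β + 1)) ^ (β + 1) * y⁻¹ := by
  have hb : 0 < 2 * (β + 1) := by linarith
  have h1 : y / (2 * (β + 1)) ≤ Real.exp (y / (2 * (β + 1))) :=
    (le_add_of_nonneg_right zero_le_one).trans (Real.add_one_le_exp _)
  have h2 := Real.rpow_le_rpow (by positivity) h1 (by linarith : (0 : ℝ) ≤ β + 1)
  rw [← Real.exp_mul, Real.div_rpow hy.le hb.le, div_le_iff₀ (by positivity),
    show y / (2 * (β + 1)) * (β + 1) = y / 2 by field_simp, Real.rpow_add_one hy.ne'] at h2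
  rw [Real.exp_neg, ← div_eq_mul_inv, ← div_eq_mul_inv, div_le_div_iff₀ (Real.exp_pos _) hy]
  linarith

variable {Ω : Type*} [MeasurableSpace Ω] {P : Measure Ω} {ξ : ℕ → Ω → ℝ} {x q : ℝ}

lemma integral_iicIndicator_comp {Z : Ω → ℝ} (hZ : Measurable Z) :
    ∫ ω, iicIndicator x (Z ω) ∂P = P.real {ω | Z ω ≤ x} := by
  have : (fun ω => iicIndicator x (Z ω)) = Set.indicator {ω | Z ω ≤ x} 1 := by
    funext ω; simp [iicIndicator_eq, Set.indicator]
  rw [this, integral_indicator_one (measurableSet_le hZ measurable_const)]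

lemma measurable_count (hξ : ∀ i, Measurable (ξ i)) (m : ℕ) :
    Measurable fun ω => (((Finset.range m).filter (fun i => ξ i ω ≤ x)).card : ℝ) := by
  simp only [card_filter_eq_sum_iicIndicator]
  exact Finset.measurable_fun_sum _ fun i _ => (measurable_iicIndicator x).comp (hξ i)

variable [IsProbabilityMeasure P]

lemma integrable_iicIndicator_comp {Z : Ω → ℝ} (hZ : Measurable Z) :
    Integrable (fun ω => iicIndicator x (Z ω)) P := by
  refine Integrable.of_bound ((measurable_iicIndicator x).comp hZ).aestronglyMeasurable 1
    (Eventually.of_forall fun ω => ?_)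
  rw [iicIndicator_eq]; split_ifs <;> simp

lemma mgf_iicIndicator_le {Z : Ω → ℝ} (hZ : Measurable Z) (hq : P.real {ω | Z ω ≤ x} = q) :
    mgf (fun ω => iicIndicator x (Z ω)) P (-1) ≤ Real.exp (-(5 / 8 * q)) := by
  have h : (fun ω => Real.exp (-1 * iicIndicator x (Z ω))) =
      fun ω => 1 - (1 - Real.exp (-1)) * iicIndicator x (Z ω) := by
    funext ω; rw [iicIndicator_eq]; split_ifs <;> simp
  rw [mgf, h, integral_sub (integrable_const _) ((integrable_iicIndicator_comp hZ).const_mul _),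
    integral_const_mul, integral_iicIndicator_comp hZ, hq]
  have he : Real.exp (-1) ≤ 3 / 8 := by
    rw [Real.exp_neg, inv_le_comm₀ (Real.exp_pos 1) (by norm_num)]
    linarith [Real.exp_one_gt_d9]
  have hq0 : 0 ≤ q := hq ▸ measureReal_nonneg
  have := Real.add_one_le_exp (-(5 / 8 * q))
  simp only [integral_const, probReal_univ, smul_eq_mul, mul_one]
  nlinarith

/-- Chernoff's bound with parameter -1: since 1 - e^{-1} ≥ 5/8, the exponent is mq/8 - 5mq/8 =
-mq/2. -/
lemma measure_count_le (hξ : ∀ i, Measurable (ξ i)) (hindep : iIndepFun ξ P)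
    (hq : ∀ i, P.real {ω | ξ i ω ≤ x} = q) (m : ℕ) :
    P {ω | (((Finset.range m).filter (fun i => ξ i ω ≤ x)).card : ℝ) ≤ m * q / 8} ≤
      ENNReal.ofReal (Real.exp (-(m * q / 2))) := by
  set Z : ℕ → Ω → ℝ := fun i ω => iicIndicator x (ξ i ω) with hZ
  have hZm : ∀ i, Measurable (Z i) := fun i => (measurable_iicIndicator x).comp (hξ i)
  have hZi : iIndepFun Z P := hindep.comp (fun _ => iicIndicator x) fun _ => measurable_iicIndicator x
  have hint : Integrable (fun ω => Real.exp (-1 * (∑ i ∈ Finset.range m, Z i) ω)) P := by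
    refine Integrable.of_bound (by fun_prop) 1 (Eventually.of_forall fun ω => ?_)
    rw [Real.norm_of_nonneg (Real.exp_pos _).le, Real.exp_le_one_iff, Finset.sum_apply]
    have : 0 ≤ ∑ i ∈ Finset.range m, Z i ω := Finset.sum_nonneg fun i _ => by
      simp only [hZ, iicIndicator_eq]; split_ifs <;> norm_num
    linarith
  have h := measure_le_le_exp_mul_mgf (μ := P) (t := -1) (m * q / 8) (by norm_num) hint
  rw [hZi.mgf_sum hZm] at h
  have hprod : ∏ i ∈ Finset.range m, mgf (Z i) P (-1) ≤ Real.exp (-(5 / 8 * q)) ^ m := by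
    rw [← Finset.card_range m, ← Finset.prod_const, Finset.card_range]
    exact Finset.prod_le_prod (fun i _ => mgf_nonneg) fun i _ => mgf_iicIndicator_le (hξ i) (hq i)
  have h2 := h.trans (mul_le_mul_of_nonneg_left hprod (Real.exp_pos _).le)
  rw [← Real.exp_nat_mul, ← Real.exp_add] at h2
  rw [← ofReal_measureReal]
  refine ENNReal.ofReal_le_ofReal ?_
  have hset : {ω | (((Finset.range m).filter (fun i => ξ i ω ≤ x)).card : ℝ) ≤ m * q / 8} =
      {ω | (∑ i ∈ Finset.range m, Z i) ω ≤ m * q / 8} := by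
    ext ω
    rw [Set.mem_ofPred_eq, Set.mem_ofPred_eq, card_filter_eq_sum_iicIndicator, Finset.sum_apply]
  rw [hset]
  refine h2.trans_eq (congrArg Real.exp ?_)
  ring

/-- Uniformly in the point, the maximal inverse power of the empirical distribution function is
controlled on average by the inverse power of the distribution function. -/
lemma lintegral_iSup_empiricalCDF_rpow_le (hξ : ∀ i, Measurable (ξ i)) (hindep : iIndepFun ξ P)
    (hq : ∀ i, P.real {ω | ξ i ω ≤ x} = q) (hq0 : 0 < q) {β : ℝ} (hβ : 0 < β) :
    ∫⁻ ω, ⨆ n, ENNReal.ofReal (empiricalCDF (fun i => ξ i ω) n x ^ (-β)) ∂P ≤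
      ENNReal.ofReal (16 ^ β + 2 ^ β * (2 * (β + 1)) ^ (β + 1) * 2) * ENNReal.ofReal (q ^ (-β)) := by
  set G : ℕ → Set Ω := fun j =>
    {ω | (((Finset.range (2 ^ j)).filter (fun i => ξ i ω ≤ x)).card : ℝ) ≤ 2 ^ j * q / 8} with hG
  set K := 2 ^ β * (2 * (β + 1)) ^ (β + 1) with hK
  have hK0 : 0 < K := by positivity
  have hGm : ∀ j, MeasurableSet (G j) := fun j =>
    measurableSet_le (measurable_count hξ _) measurable_const
  have hpt : ∀ ω, ⨆ n, ENNReal.ofReal (empiricalCDF (fun i => ξ i ω) n x ^ (-β)) ≤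
      ENNReal.ofReal ((16 / q) ^ β) + ∑' j : ℕ, (if 1 ≤ 2 ^ j * q then
        (G j).indicator (fun _ => ENNReal.ofReal ((2 ^ (j + 1)) ^ β)) ω else 0) := by
    intro ω
    refine iSup_le fun n => ?_
    have hmono : Monotone fun n => ((Finset.range n).filter (fun i => ξ i ω ≤ x)).card :=
      fun a b hab => Finset.card_le_card
        (Finset.filter_subset_filter _ (Finset.range_mono hab))
    refine (natCast_card_div_rpow_le hmono hq0 hβ n).trans (le_of_eq ?_)
    congr 1
    refine tsum_congr fun j => ?_
    by_cases h1 : 1 ≤ 2 ^ j * q <;> simp [h1, Set.indicator, hG]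
  refine (lintegral_mono hpt).trans ?_
  rw [lintegral_add_left measurable_const, lintegral_const, measure_univ, mul_one,
    lintegral_tsum fun j => by
      split_ifs
      · exact (measurable_const.indicator (hGm j)).aemeasurable
      · exact measurable_const.aemeasurable]
  have hterm : ∀ j : ℕ, ∫⁻ ω, (if 1 ≤ 2 ^ j * q then
      (G j).indicator (fun _ => ENNReal.ofReal ((2 ^ (j + 1)) ^ β)) ω else 0) ∂P ≤
      ENNReal.ofReal (K * q ^ (-β)) *
        (if 1 ≤ 2 ^ j * q then ENNReal.ofReal ((2 ^ j * q)⁻¹) else 0) := by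
    intro j
    split_ifs with h1
    · rw [lintegral_indicator_const (hGm j)]
      have hm := measure_count_le hξ hindep hq (2 ^ j)
      push_cast at hm
      refine (mul_le_mul_right hm _).trans ?_
      rw [← ENNReal.ofReal_mul (by positivity), ← ENNReal.ofReal_mul (by positivity)]
      refine ENNReal.ofReal_le_ofReal ?_
      have hy : 0 < 2 ^ j * q := by positivity
      have h := rpow_mul_exp_neg_half_le hβ hy
      -- Splitting off q^{-β} leaves a function of 2^j q alone, whose dyadic sum is bounded
      -- independently of q.
      have h2 : ((2 : ℝ) ^ (j + 1)) ^ β = 2 ^ β * q ^ (-β) * (2 ^ j * q) ^ β := by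
        rw [Real.mul_rpow (by positivity) hq0.le, Real.rpow_neg hq0.le, pow_succ,
          Real.mul_rpow (by positivity) (by norm_num)]
        field_simp
      rw [h2]
      calc _ = 2 ^ β * q ^ (-β) * ((2 ^ j * q) ^ β * Real.exp (-(2 ^ j * q / 2))) := by ring
        _ ≤ 2 ^ β * q ^ (-β) * ((2 * (β + 1)) ^ (β + 1) * (2 ^ j * q)⁻¹) := by gcongr
        _ = _ := by rw [hK]; ring
    · simp
  refine (add_le_add_right (ENNReal.tsum_le_tsum hterm) _).trans ?_
  rw [ENNReal.tsum_mul_left]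
  refine (add_le_add_right (mul_le_mul_right (tsum_two_pow_mul_inv_le hq0) _) _).trans ?_
  rw [← ENNReal.ofReal_ofNat 2, ← ENNReal.ofReal_mul (by positivity),
    ← ENNReal.ofReal_add (by positivity) (by positivity), ← ENNReal.ofReal_mul (by positivity)]
  refine ENNReal.ofReal_le_ofReal (le_of_eq ?_)
  rw [Real.div_rpow (by norm_num) hq0.le, Real.rpow_neg hq0.le]
  ring

lemma ae_tendsto_empiricalCDF (hξ : ∀ i, Measurable (ξ i)) (hindep : iIndepFun ξ P)
    (hident : ∀ i, IdentDistrib (ξ i) (ξ 0) P P) (hq : P.real {ω | ξ 0 ω ≤ x} = q) :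
    ∀ᵐ ω ∂P, Tendsto (fun n => empiricalCDF (fun i => ξ i ω) n x) atTop (𝓝 q) := by
  have h := strong_law_ae_real (μ := P) (fun i ω => iicIndicator x (ξ i ω))
    (integrable_iicIndicator_comp (hξ 0))
    (fun i j hij => (hindep.indepFun hij).comp (measurable_iicIndicator x)
      (measurable_iicIndicator x))
    (fun i => (hident i).comp (measurable_iicIndicator x))
  rw [integral_iicIndicator_comp (hξ 0), hq] at h
  simpa only [empiricalCDF_eq] using h

end EmpiricalCDF

lemma measurable_empiricalCDF_uncurry {Ω : Type*} [MeasurableSpace Ω] {ξ : ℕ → Ω → ℝ}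
    (hξ : ∀ i, Measurable (ξ i)) (n : ℕ) :
    Measurable fun z : Ω × ℝ => empiricalCDF (fun i => ξ i z.1) n z.2 := by
  simp only [empiricalCDF_eq, iicIndicator_eq]
  refine (Finset.measurable_fun_sum _ fun i _ => ?_).div_const _
  exact Measurable.ite (measurableSet_le ((hξ i).comp measurable_fst) measurable_snd)
    measurable_const measurable_const

lemma measurable_empiricalCDF (s : ℕ → ℝ) (n : ℕ) : Measurable (empiricalCDF s n) := by
  have h : Measurable fun x => (∑ i ∈ Finset.range n, if s i ≤ x then (1 : ℝ) else 0) / n :=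
    (Finset.measurable_fun_sum _ fun i _ => Measurable.ite measurableSet_Ici
      measurable_const measurable_const).div_const _
  convert h using 1
  funext x
  simp only [empiricalCDF_eq, iicIndicator_eq]

/-! ### Convergence along a fixed sample -/

section Deterministic

variable {α : ℝ} {s : ℕ → ℝ} {F : ℝ → ℝ}

lemma ae_tendsto_pastEntropyKernel (hα0 : 0 < α) (hα1 : α < 1) (hF0 : ∀ x, 0 ≤ F x)
    (hF1 : ∀ x, F x ≤ 1)
    (hconv : ∀ᵐ x, Tendsto (fun n => empiricalCDF s n x) atTop (𝓝 (F x)))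
    (hzero : ∀ᵐ x, F x = 0 → ∀ n, empiricalCDF s n x = 0) :
    ∀ᵐ x, Tendsto (fun n => ENNReal.ofReal (pastEntropyKernel α (empiricalCDF s n x))) atTop
      (𝓝 (ENNReal.ofReal (pastEntropyKernel α (F x)))) := by
  filter_upwards [hconv, hzero] with x hx hx0
  refine ENNReal.tendsto_ofReal ?_
  rcases (hF0 x).eq_or_lt with h | h
  -- The kernel is unbounded near 0 though its value there is 0, so convergence needs the empirical
  -- values to vanish exactly.
  · simp only [hx0 h.symm, ← h]
    exact tendsto_const_nhds
  · refine (continuousOn_pastEntropyKernel hα0 hα1 (F x) ⟨h, hF1 x⟩).tendsto.comp ?_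
    refine tendsto_nhdsWithin_iff.2 ⟨hx, ?_⟩
    filter_upwards [hx.eventually (lt_mem_nhds h)] with n hn
    exact ⟨hn, empiricalCDF_le_one s n x⟩

lemma exists_dominating_pastEntropyKernel (hα0 : 0 < α) (hα1 : α < 1) {p M : ℝ} (hp : 1 < p)
    (hM : ∀ n : ℕ, (∑ i ∈ Finset.range n, |s i| ^ p) / n ≤ M)
    (hD : ∀ K : ℕ, ∫⁻ x in Set.Ioc (0 : ℝ) K,
      ⨆ n, ENNReal.ofReal (empiricalCDF s n x ^ (-(1 / α - 1))) ≠ ⊤) :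
    ∃ bound : ℝ → ENNReal, ∫⁻ x in Set.Ioi (0 : ℝ), bound x ≠ ⊤ ∧ ∀ x, 0 < x → ∀ n,
      ENNReal.ofReal (pastEntropyKernel α (empiricalCDF s n x)) ≤ bound x := by
  set β := 1 / α - 1 with hβ
  have hβ0 : 0 < β := by
    have : 1 < 1 / α := by rw [lt_div_iff₀ hα0]; linarith
    linarith
  obtain ⟨C, hC0, hC⟩ := pastEntropyKernel_le hα0 hα1
  -- For n = 0 the average is 0/0 = 0.
  have hM0 : 0 ≤ M := by simpa using hM 0
  have hlim := ((tendsto_rpow_neg_atTop (by linarith : 0 < p)).comp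
    tendsto_natCast_atTop_atTop).const_mul M
  rw [mul_zero] at hlim
  -- Beyond K the tail bound M x^{-p} is below 1/2, so the empirical distribution function stays
  -- above 1/2 and its inverse power is bounded.
  obtain ⟨K, hK, hK1⟩ :=
    ((hlim.eventually_lt_const (by norm_num : (0 : ℝ) < 1 / 2)).and (eventually_ge_atTop 1)).exists
  have hK0 : (0 : ℝ) < K := by exact_mod_cast hK1
  set D : ℝ → ENNReal := fun x => ⨆ n, ENNReal.ofReal (empiricalCDF s n x ^ (-β)) with hDdef
  have hDm : Measurable D := Measurable.iSup fun n =>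
    ((measurable_empiricalCDF s n).pow_const _).ennreal_ofReal
  refine ⟨fun x => (Set.Ioc (0 : ℝ) K).indicator (fun x => ENNReal.ofReal C * D x) x +
    (Set.Ioi (K : ℝ)).indicator (fun x => ENNReal.ofReal (C * (1 / 2) ^ (-β) * M * x ^ (-p))) x,
    ?_, fun x hx n => ?_⟩
  · refine ne_top_of_le_ne_top ?_ (setLIntegral_le_lintegral _ _)
    rw [lintegral_add_left ((hDm.const_mul _).indicator measurableSet_Ioc),
      lintegral_indicator measurableSet_Ioc, lintegral_indicator measurableSet_Ioi,
      lintegral_const_mul _ hDm]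
    refine ENNReal.add_ne_top.2 ⟨ENNReal.mul_ne_top ENNReal.ofReal_ne_top (hD K), ?_⟩
    exact ((integrableOn_Ioi_rpow_of_lt (by linarith : -p < -1) hK0).const_mul _).lintegral_lt_top.ne
  · rcases (empiricalCDF_nonneg s n x).eq_or_lt with h0 | h0
    · rw [← h0, pastEntropyKernel_zero]; simp
    have h1 := empiricalCDF_le_one s n x
    have hle := hC _ h0 h1
    have hpow : 0 < empiricalCDF s n x ^ (-β) := by positivity
    rcases le_or_gt x K with hxK | hxK
    · refine le_trans ?_ le_self_add
      rw [Set.indicator_of_mem (show x ∈ Set.Ioc (0 : ℝ) K from ⟨hx, hxK⟩)]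
      calc ENNReal.ofReal (pastEntropyKernel α (empiricalCDF s n x))
          ≤ ENNReal.ofReal (C * empiricalCDF s n x ^ (-β)) := by
            refine ENNReal.ofReal_le_ofReal (hle.trans (mul_le_mul_of_nonneg_left ?_ hC0.le))
            exact mul_le_of_le_one_left hpow.le (by linarith)
        _ = ENNReal.ofReal C * ENNReal.ofReal (empiricalCDF s n x ^ (-β)) :=
            ENNReal.ofReal_mul hC0.le
        _ ≤ _ := mul_le_mul_right
            (le_iSup (fun n => ENNReal.ofReal (empiricalCDF s n x ^ (-β))) n) _
    · refine le_trans ?_ le_add_self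
      rw [Set.indicator_of_mem (show x ∈ Set.Ioi (K : ℝ) from hxK)]
      refine ENNReal.ofReal_le_ofReal (hle.trans ?_)
      have hn : 1 ≤ n := by
        by_contra! hn
        have : n = 0 := by omega
        subst this
        simp [empiricalCDF] at h0
      have htail : 1 - empiricalCDF s n x ≤ M * x ^ (-p) :=
        (one_sub_empiricalCDF_le s hn hx (by linarith)).trans
          (mul_le_mul_of_nonneg_right (hM n) (by positivity))
      have hxp : M * x ^ (-p) ≤ M * (K : ℝ) ^ (-p) :=
        mul_le_mul_of_nonneg_left
          (Real.rpow_le_rpow_of_nonpos hK0 hxK.le (by linarith)) hM0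
      simp only [Function.comp_apply] at hK
      have hhalf : 1 / 2 ≤ empiricalCDF s n x := by linarith
      have hb : empiricalCDF s n x ^ (-β) ≤ (1 / 2 : ℝ) ^ (-β) :=
        Real.rpow_le_rpow_of_nonpos (by norm_num) hhalf (by linarith)
      calc C * ((1 - empiricalCDF s n x) * empiricalCDF s n x ^ (-β))
          ≤ C * ((M * x ^ (-p)) * (1 / 2 : ℝ) ^ (-β)) := by
            refine mul_le_mul_of_nonneg_left ?_ hC0.le
            exact mul_le_mul htail hb hpow.le (by positivity)
        _ = _ := by ring

/-- Convergence of the entropies of empirical distribution functions along a fixed sample. -/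
lemma tendsto_efcpe_empiricalCDF (hα0 : 0 < α) (hα1 : α < 1) (hF0 : ∀ x, 0 ≤ F x)
    (hF1 : ∀ x, F x ≤ 1)
    (hconv : ∀ᵐ x, Tendsto (fun n => empiricalCDF s n x) atTop (𝓝 (F x)))
    (hzero : ∀ᵐ x, F x = 0 → ∀ n, empiricalCDF s n x = 0)
    {p M : ℝ} (hp : 1 < p) (hM : ∀ n : ℕ, (∑ i ∈ Finset.range n, |s i| ^ p) / n ≤ M)
    (hD : efcpe α F ≠ ⊤ → ∀ K : ℕ, ∫⁻ x in Set.Ioc (0 : ℝ) K,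
      ⨆ n, ENNReal.ofReal (empiricalCDF s n x ^ (-(1 / α - 1))) ≠ ⊤) :
    Tendsto (fun n => efcpe α (empiricalCDF s n)) atTop (𝓝 (efcpe α F)) := by
  have hpt := ae_restrict_of_ae (s := Set.Ioi (0 : ℝ))
    (ae_tendsto_pastEntropyKernel hα0 hα1 hF0 hF1 hconv hzero)
  have hmeas : ∀ n, Measurable fun x =>
      ENNReal.ofReal (pastEntropyKernel α (empiricalCDF s n x)) := fun n =>
    (measurable_pastEntropyKernel_comp hα0 hα1 (measurable_empiricalCDF s n)
      (empiricalCDF_nonneg s n) (empiricalCDF_le_one s n)).ennreal_ofReal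
  by_cases htop : efcpe α F = ⊤
  · have h : efcpe α F ≤ liminf (fun n => efcpe α (empiricalCDF s n)) atTop := by
      calc efcpe α F = ∫⁻ x in Set.Ioi (0 : ℝ), liminf (fun n =>
            ENNReal.ofReal (pastEntropyKernel α (empiricalCDF s n x))) atTop := by
            refine lintegral_congr_ae ?_
            filter_upwards [hpt] with x hx
            exact hx.liminf_eq.symm
        _ ≤ _ := lintegral_liminf_le hmeas
    -- Fatou forces the lower limit to be infinite.
    exact tendsto_of_le_liminf_of_limsup_le h (htop ▸ le_top)
  · obtain ⟨bound, hfin, hbound⟩ := exists_dominating_pastEntropyKernel hα0 hα1 hp hM (hD htop)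
    refine tendsto_lintegral_of_dominated_convergence bound hmeas (fun n => ?_) hfin hpt
    filter_upwards [ae_restrict_mem measurableSet_Ioi] with x hx
    exact hbound x hx n

/-- Where F ≤ 1/2 the kernel dominates F^{-β}; where F > 1/2 the power is bounded by a constant,
hence the restriction to a bounded interval. -/
lemma lintegral_rpow_ne_top_of_efcpe_ne_top (hα0 : 0 < α) (hα1 : α < 1) (hF : Measurable F)
    (hF0 : ∀ x, 0 ≤ F x) (hF1 : ∀ x, F x ≤ 1) (h : efcpe α F ≠ ⊤) (K : ℕ) :
    ∫⁻ x in Set.Ioc (0 : ℝ) K, ENNReal.ofReal (F x ^ (-(1 / α - 1))) ≠ ⊤ := by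
  set β := 1 / α - 1 with hβ
  have hβ0 : 0 < β := by
    have : 1 < 1 / α := by rw [lt_div_iff₀ hα0]; linarith
    linarith
  obtain ⟨c, hc0, hc⟩ := pastEntropyKernel_ge hα0 hα1
  have hle : ∀ x, ENNReal.ofReal (F x ^ (-β)) ≤ ENNReal.ofReal ((1 / 2) ^ (-β)) +
      ENNReal.ofReal c⁻¹ * ENNReal.ofReal (pastEntropyKernel α (F x)) := by
    intro x
    rcases (hF0 x).eq_or_lt with h0 | h0
    · rw [← h0, Real.zero_rpow (by linarith)]; simp
    rcases le_or_gt (F x) (1 / 2) with h2 | h2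
    · refine le_trans ?_ le_add_self
      rw [← ENNReal.ofReal_mul (by positivity)]
      refine ENNReal.ofReal_le_ofReal ?_
      rw [le_inv_mul_iff₀ hc0]
      exact hc _ h0 h2
    · refine le_trans ?_ le_self_add
      exact ENNReal.ofReal_le_ofReal
        (Real.rpow_le_rpow_of_nonpos (by norm_num) h2.le (by linarith))
  refine ne_top_of_le_ne_top ?_ (lintegral_mono hle)
  rw [lintegral_add_left measurable_const, lintegral_const_mul _
    (measurable_pastEntropyKernel_comp hα0 hα1 hF hF0 hF1).ennreal_ofReal, lintegral_const]
  refine ENNReal.add_ne_top.2 ⟨ENNReal.mul_ne_top ENNReal.ofReal_ne_top (by simp),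
    ENNReal.mul_ne_top ENNReal.ofReal_ne_top ?_⟩
  exact ne_top_of_le_ne_top h (lintegral_mono_set Set.Ioc_subset_Ioi_self)

end Deterministic

/-! ### Almost sure statements for the random sample -/

section Random

variable {Ω : Type*} [MeasurableSpace Ω] {P : Measure Ω} [IsProbabilityMeasure P]
  {ξ : ℕ → Ω → ℝ} {F : ℝ → ℝ}

lemma ae_empiricalCDF_eq_zero {x : ℝ} (hq : ∀ i, P.real {ω | ξ i ω ≤ x} = 0) :
    ∀ᵐ ω ∂P, ∀ n, empiricalCDF (fun i => ξ i ω) n x = 0 := by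
  have h : ∀ᵐ ω ∂P, ∀ i, ¬ ξ i ω ≤ x := by
    rw [ae_all_iff]
    intro i
    have := hq i
    rw [measureReal_eq_zero_iff] at this
    rw [ae_iff]
    simpa only [not_not] using this
  filter_upwards [h] with ω hω n
  simp [empiricalCDF, hω]

lemma ae_lintegral_iSup_ne_top (hξ : ∀ i, Measurable (ξ i)) (hindep : iIndepFun ξ P)
    (hF0 : ∀ x, 0 ≤ F x) (hq : ∀ i x, P.real {ω | ξ i ω ≤ x} = F x) {β : ℝ} (hβ : 0 < β)
    {K : ℕ} (hfin : ∫⁻ x in Set.Ioc (0 : ℝ) K, ENNReal.ofReal (F x ^ (-β)) ≠ ⊤) :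
    ∀ᵐ ω ∂P, ∫⁻ x in Set.Ioc (0 : ℝ) K,
      ⨆ n, ENNReal.ofReal (empiricalCDF (fun i => ξ i ω) n x ^ (-β)) ≠ ⊤ := by
  set D : Ω → ℝ → ENNReal := fun ω x =>
    ⨆ n, ENNReal.ofReal (empiricalCDF (fun i => ξ i ω) n x ^ (-β)) with hD
  have hDm : Measurable (Function.uncurry D) := Measurable.iSup fun n =>
    ((measurable_empiricalCDF_uncurry hξ n).pow_const _).ennreal_ofReal
  have hmean : ∀ x, ∫⁻ ω, D ω x ∂P ≤
      ENNReal.ofReal (16 ^ β + 2 ^ β * (2 * (β + 1)) ^ (β + 1) * 2) *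
        ENNReal.ofReal (F x ^ (-β)) := by
    intro x
    rcases (hF0 x).eq_or_lt with h0 | h0
    · refine le_trans (le_of_eq ?_) zero_le
      refine lintegral_eq_zero_of_ae_eq_zero ?_
      filter_upwards [ae_empiricalCDF_eq_zero (x := x) fun i => (hq i x).trans h0.symm] with ω hω
      simp [hD, hω, Real.zero_rpow (neg_ne_zero.2 hβ.ne')]
    · exact lintegral_iSup_empiricalCDF_rpow_le hξ hindep (fun i => hq i x) h0 hβ
  have htot : ∫⁻ ω, (∫⁻ x in Set.Ioc (0 : ℝ) K, D ω x) ∂P ≠ ⊤ := by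
    -- Tonelli turns the pointwise maximal inequality into a finite mean for the integral over (0,
    -- K].
    rw [lintegral_lintegral_swap hDm.aemeasurable]
    refine ne_top_of_le_ne_top ?_ (lintegral_mono hmean)
    rw [lintegral_const_mul' _ _ ENNReal.ofReal_ne_top]
    exact ENNReal.mul_ne_top ENNReal.ofReal_ne_top hfin
  filter_upwards [ae_lt_top hDm.lintegral_prod_right' htot] with ω hω
  exact hω.ne

lemma ae_tendsto_efcpe_of_measurable {α : ℝ} (hα0 : 0 < α) (hα1 : α < 1)
    (hξ : ∀ i, Measurable (ξ i)) (hindep : iIndepFun ξ P)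
    (hident : ∀ i, IdentDistrib (ξ i) (ξ 0) P P) {p : ℝ} (hp : 1 < p)
    (hint : Integrable (fun ω => |ξ 0 ω| ^ p) P)
    (hF : Measurable F) (hq : ∀ i x, P.real {ω | ξ i ω ≤ x} = F x) :
    ∀ᵐ ω ∂P, Tendsto (fun n : ℕ => efcpe α (empiricalCDF (fun i => ξ i ω) n)) atTop
      (𝓝 (efcpe α F)) := by
  have hF0 : ∀ x, 0 ≤ F x := fun x => hq 0 x ▸ measureReal_nonneg
  have hF1 : ∀ x, F x ≤ 1 := fun x => hq 0 x ▸ measureReal_le_one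
  have hβ0 : 0 < 1 / α - 1 := by
    have : 1 < 1 / α := by rw [lt_div_iff₀ hα0]; linarith
    linarith
  have hconv : ∀ᵐ ω ∂P, ∀ᵐ x, Tendsto (fun n => empiricalCDF (fun i => ξ i ω) n x) atTop
      (𝓝 (F x)) := by
    -- Exchanging the almost-everywhere quantifiers reduces the claim to the strong law at each
    -- single x, with no uniform convergence needed.
    rw [Measure.ae_ae_comm (measurableSet_tendsto_fun
      (fun n => measurable_empiricalCDF_uncurry hξ n) (hF.comp measurable_snd))]
    exact Eventually.of_forall fun x => ae_tendsto_empiricalCDF hξ hindep hident (hq 0 x)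
  have hzero : ∀ᵐ ω ∂P, ∀ᵐ x, F x = 0 → ∀ n, empiricalCDF (fun i => ξ i ω) n x = 0 := by
    rw [Measure.ae_ae_comm]
    · refine Eventually.of_forall fun x => ?_
      by_cases hx : F x = 0
      · simpa [hx] using ae_empiricalCDF_eq_zero (x := x) fun i => (hq i x).trans hx
      · simp [hx]
    · simp only [imp_iff_not_or, Set.ofPred_or, Set.ofPred_forall]
      exact (measurableSet_eq_fun (hF.comp measurable_snd) measurable_const).compl.union
        (MeasurableSet.iInter fun n =>
          measurableSet_eq_fun (measurable_empiricalCDF_uncurry hξ n) measurable_const)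
  have hpm : Measurable fun y : ℝ => |y| ^ p := measurable_abs.pow_const p
  have hmom := strong_law_ae_real (μ := P) (fun i ω => |ξ i ω| ^ p) hint
    (fun i j hij => (hindep.indepFun hij).comp hpm hpm) (fun i => (hident i).comp hpm)
  have hD : efcpe α F ≠ ⊤ → ∀ᵐ ω ∂P, ∀ K : ℕ, ∫⁻ x in Set.Ioc (0 : ℝ) K,
      ⨆ n, ENNReal.ofReal (empiricalCDF (fun i => ξ i ω) n x ^ (-(1 / α - 1))) ≠ ⊤ := fun htop =>
    ae_all_iff.2 fun K => ae_lintegral_iSup_ne_top hξ hindep hF0 hq hβ0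
      (lintegral_rpow_ne_top_of_efcpe_ne_top hα0 hα1 hF hF0 hF1 htop K)
  filter_upwards [hconv, hzero, hmom, eventually_imp_distrib_left.2 hD] with ω h1 h2 h3 h4
  obtain ⟨M, hM⟩ := h3.bddAbove_range
  exact tendsto_efcpe_empiricalCDF hα0 hα1 hF0 hF1 h1 h2 hp
    (fun n => hM (Set.mem_range_self n)) h4

end Random

theorem theorem4p1 {Ω₀ Ω : Type*} [MeasurableSpace Ω₀] [MeasurableSpace Ω]
    (P₀ : Measure Ω₀) [IsProbabilityMeasure P₀] (P : Measure Ω) [IsProbabilityMeasure P]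
    (α : ℝ) (hα0 : 0 < α) (hα1 : α < 1)
    -- the population variable
    (X : Ω₀ → ℝ) (hX : AEMeasurable X P₀) (hX0 : ∀ᵐ ω ∂P₀, 0 ≤ X ω)
    (p : ℝ) (hp : 1 < p) (hXp : Integrable (fun ω => |X ω| ^ p) P₀)
    -- the random sample: independent copies of `X`
    (ξ : ℕ → Ω → ℝ) (hindep : iIndepFun ξ P) (hident : ∀ i, IdentDistrib (ξ i) X P P₀) :
    ∀ᵐ ω ∂P, Tendsto (fun n : ℕ => efcpe α (empiricalCDF (fun i => ξ i ω) n)) atTop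
      (𝓝 (efcpe α (fun x => cdf (P₀.map X) x))) := by
  have hae : ∀ i, AEMeasurable (ξ i) P := fun i => (hident i).aemeasurable_fst
  -- Measurable versions of the sample; almost surely all countably many agree with the original
  -- variables.
  set η : ℕ → Ω → ℝ := fun i => (hae i).mk (ξ i) with hη
  have hηm : ∀ i, Measurable (η i) := fun i => (hae i).measurable_mk
  have hξη : ∀ i, ξ i =ᵐ[P] η i := fun i => (hae i).ae_eq_mk
  have hηX : ∀ i, IdentDistrib (η i) X P P₀ := fun i =>
    (IdentDistrib.of_ae_eq (hae i) (hξη i)).symm.trans (hident i)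
  have hηi : iIndepFun η P := hindep.congr hξη
  have hpm : Measurable fun y : ℝ => |y| ^ p := measurable_abs.pow_const p
  have : IsProbabilityMeasure (P₀.map X) := Measure.isProbabilityMeasure_map hX
  have hq : ∀ i x, P.real {ω | η i ω ≤ x} = cdf (P₀.map X) x := by
    intro i x
    rw [cdf_eq_real, ← (hηX i).map_eq, map_measureReal_apply (hηm i) measurableSet_Iic]
    rfl
  have h := ae_tendsto_efcpe_of_measurable hα0 hα1 hηm hηi
    (fun i => (hηX i).trans (hηX 0).symm) hp
    (((hηX 0).comp hpm).integrable_iff.2 hXp) (monotone_cdf (P₀.map X)).measurable hq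
  filter_upwards [h, ae_all_iff.2 hξη] with ω hω hω'
  simpa only [hω'] using hω
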